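/- Let $X\ge 0$ be a random variable with Laplace transform $L_X(s)=E(e^{-sX})$, $s\ge 0$, and suppose that $p=P(X=0)<1/e$. Let $X_1,X_2,\dots$ be independent copies of $X$, let $L_n(s)=\frac1n\sum_{i=1}^n e^{-sX_i}$, and let $A=A_n$ be the solution $A>0$ of $L_n(A)=e^{-1}$ whenever such a solution exists (it is then almost surely unique), and an arbitrary constant $d_n$ otherwise. For $a>0$ and $r\in\mathbb N$ put $m_{r,a}=E(X^re^{-aX})$ and $\widehat m_{r,A}=\frac1n\sum_{i=1}^nX_i^re^{-AX_i}$. Let $k\ge 1$ be an integer. Then the following hold as $n\to\infty$. (0) The equation $L_X(s)=1/e$ has exactly one solution in $[0,\infty)$, denoted $a_*=L_X^{-1}(1/e)$, and $a_*>0$; almost surely, for all sufficiently large $n$, the equation $L_n(s)=1/e$ has exactly one solution $s>0$. (1) The random vector $(\widehat m_{1,A},\dots,\widehat m_{k,A},A)$ converges almost surely to $(m_{1,a_*},\dots,m_{k,a_*},a_*)$. (2) The random vector $\sqrt n\,(\widehat m_{1,A}-m_{1,a_*},\dots,\widehat m_{k,A}-m_{k,a_*},A-a_*)$ converges in distribution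 to the (possibly degenerate) multivariate normal law $\mathrm N_{k+1}(0,\Sigma)$, where $\Sigma$ is the variance-covariance matrix of the random vector $(V_1,\dots,V_k,W)$ with $$V_r=e^{-a_*X}\Big(X^r-\frac{m_{r+1,a_*}}{m_{1,a_*}}\Big)\quad(r=1,\dots,k),\qquad W=\frac{e^{-a_*X}}{m_{1,a_*}}.$$ (3) The sample variance-covariance matrix (with divisor $n-1$) of the vectors $(\widehat V_{1,i},\dots,\widehat V_{k,i},\widehat W_i)$, $i=1,\dots,n$, where $$\widehat V_{r,i}=e^{-AX_i}\Big(X_i^r-\frac{\widehat m_{r+1,A}}{\widehat m_{1,A}}\Big),\qquad \widehat W_i=\frac{e^{-AX_i}}{\widehat m_{1,A}},$$ is a consistent estimator of $\Sigma$: it converges to $\Sigma$ in probability, and indeed almost surely. -/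

import Mathlib

open MeasureTheory ProbabilityTheory Filter Topology

namespace LaplaceMoments

noncomputable section

/-! ### Population quantities -/

/-- The Laplace transform `L_X(s) = E(e^{-sX})`. -/
def laplace {Ω : Type*} [MeasurableSpace Ω] (P : Measure Ω) (X : Ω → ℝ) (s : ℝ) : ℝ :=
  ∫ ω, Real.exp (-(s * X ω)) ∂P

/-- The moment `m_{r,a} = E(X^r e^{-aX})`. -/
def moment {Ω : Type*} [MeasurableSpace Ω] (P : Measure Ω) (X : Ω → ℝ) (a : ℝ) (r : ℕ) : ℝ :=
  ∫ ω, X ω ^ r * Real.exp (-(a * X ω)) ∂P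

/-- `a_* = L_X^{-1}(1/e)`, where `L_X` is viewed as a function on `[0, ∞)`. -/
def aStar {Ω : Type*} [MeasurableSpace Ω] (P : Measure Ω) (X : Ω → ℝ) : ℝ :=
  Function.invFunOn (laplace P X) (Set.Ici 0) (Real.exp (-1))

/-! ### Sample quantities: a sample of size `n` is `x 0, …, x (n - 1)` -/

/-- The empirical Laplace transform `L_n(s) = n⁻¹ ∑ e^{-s xᵢ}`. -/
def empLaplace (n : ℕ) (x : ℕ → ℝ) (s : ℝ) : ℝ :=
  (∑ i ∈ Finset.range n, Real.exp (-(s * x i))) / n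

open scoped Classical in
/-- The positive root `A` of `L_n(A) = 1/e`, if there is one (for a nonnegative sample it is then
unique); otherwise the conventional value `d`. -/
def empRoot (d : ℝ) (n : ℕ) (x : ℕ → ℝ) : ℝ :=
  if h : ∃ s : ℝ, 0 < s ∧ empLaplace n x s = Real.exp (-1) then h.choose else d

/-- The empirical moment `n⁻¹ ∑ xᵢ^r e^{-a xᵢ}`. -/
def empMoment (n : ℕ) (x : ℕ → ℝ) (a : ℝ) (r : ℕ) : ℝ :=
  (∑ i ∈ Finset.range n, x i ^ r * Real.exp (-(a * x i))) / n

/-- The sample variance-covariance matrix, with divisor `n - 1`, of `z 0, …, z (n - 1)`. -/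
def sampleCov {ι : Type*} (n : ℕ) (z : ℕ → EuclideanSpace ℝ ι) : Matrix ι ι ℝ :=
  Matrix.of fun p q =>
    (∑ i ∈ Finset.range n,
      (z i p - (∑ l ∈ Finset.range n, z l p) / n) *
        (z i q - (∑ l ∈ Finset.range n, z l q) / n)) / ((n : ℝ) - 1)

/-! ### Random vectors with `k + 1` coordinates -/

/-- The vector `(v 0, …, v (k - 1), w)` of the Euclidean space of dimension `k + 1`. -/
def vec (k : ℕ) (v : ℕ → ℝ) (w : ℝ) : EuclideanSpace ℝ (Fin (k + 1)) :=
  WithLp.toLp 2 (Fin.snoc (α := fun _ => ℝ) (fun r : Fin k => v r) w)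

/-- The vector `(m 1, …, m k, a)`. -/
def paramVec (k : ℕ) (m : ℕ → ℝ) (a : ℝ) : EuclideanSpace ℝ (Fin (k + 1)) :=
  vec k (fun r => m (r + 1)) a

/-- The vector `(V_1, …, V_k, W)` at the observation `x`, where
`V_r = e^{-ax} (x^r - m (r + 1) / m 1)` and `W = e^{-ax} / m 1`. -/
def scoreVec (k : ℕ) (m : ℕ → ℝ) (a x : ℝ) : EuclideanSpace ℝ (Fin (k + 1)) :=
  vec k (fun r => Real.exp (-(a * x)) * (x ^ (r + 1) - m (r + 2) / m 1))
    (Real.exp (-(a * x)) / m 1)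

/-- The variance-covariance matrix of a random vector. -/
def covMat {Ω ι : Type*} [MeasurableSpace Ω] (P : Measure Ω) (Z : Ω → EuclideanSpace ℝ ι) :
    Matrix ι ι ℝ :=
  Matrix.of fun p q => covariance (fun ω => Z ω p) (fun ω => Z ω q) P

/-- The matrix `Σ`, the variance-covariance matrix of `(V_1, …, V_k, W)` with
`V_r = e^{-a_* X} (X^r - m_{r+1,a_*} / m_{1,a_*})` and `W = e^{-a_* X} / m_{1,a_*}`. -/
def asympCov {Ω : Type*} [MeasurableSpace Ω] (k : ℕ) (P : Measure Ω) (X : Ω → ℝ) :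
    Matrix (Fin (k + 1)) (Fin (k + 1)) ℝ :=
  covMat P fun ω => scoreVec k (moment P X (aStar P X)) (aStar P X) (X ω)

/-- The target `(m_{1,a_*}, …, m_{k,a_*}, a_*)`. -/
def target {Ω : Type*} [MeasurableSpace Ω] (k : ℕ) (P : Measure Ω) (X : Ω → ℝ) :
    EuclideanSpace ℝ (Fin (k + 1)) :=
  paramVec k (moment P X (aStar P X)) (aStar P X)

/-- The estimator `(m̂_{1,A}, …, m̂_{k,A}, A)` computed from the sample `x 0, …, x (n - 1)`. -/
def estimator (k : ℕ) (d : ℝ) (n : ℕ) (x : ℕ → ℝ) : EuclideanSpace ℝ (Fin (k + 1)) :=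
  paramVec k (empMoment n x (empRoot d n x)) (empRoot d n x)

/-- The sample variance-covariance matrix of the plug-in vectors
`(V̂_{1,i}, …, V̂_{k,i}, Ŵ_i)`, `i = 0, …, n - 1`. -/
def covEstimator (k : ℕ) (d : ℝ) (n : ℕ) (x : ℕ → ℝ) : Matrix (Fin (k + 1)) (Fin (k + 1)) ℝ :=
  sampleCov n fun i => scoreVec k (empMoment n x (empRoot d n x)) (empRoot d n x) (x i)

end

end LaplaceMoments

open LaplaceMoments

/-!
The estimator is a Z-estimator: `A` solves `L_n(A) = 1/e`, and everything else is an empirical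
moment evaluated at `A`. Two facts drive the proof. For `b > 0` the functions `x^r e^{-bx}` are
bounded on `[0, ∞)`, so the law of large numbers and the central limit theorem apply to them without
any moment assumption on `X`; and `A ↦ m̂_{r,A}` has derivative `-m̂_{r+1,A}`, with a second-order
remainder bounded uniformly in the sample (`abs_empMoment_taylor_le`).

*Consistency.* `L_X` decreases strictly from `1` to `P(X = 0) < 1/e`, so it crosses `1/e` once, at
`a > 0`. Almost surely `L_n → L_X` at all positive rationals, which traps the root of `L_n` near `a`
(`eventually_exists_root_near`). The uniform Lipschitz bound then gives `m̂_{r,A} → m_{r,a}`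
(`tendsto_empMoment`).

*Asymptotic normality.* Put `U_n = L_n(a) - 1/e`. Expanding `L_n(A) = 1/e` around `a` gives
`A - a = U_n / m_1 + o(U_n)`, and then `m̂_{r,A} - m̂_{r,a} = -(m_{r+1} / m_1) U_n + o(U_n)`.
So, pathwise, the normalized error equals the normalized sum `S_n` of the centred scores
`(V_1, …, V_k, W)` up to `o(‖S_n‖)` (`isLittleO_estimator_sub`). Such an error does not change the
limit law (`tendstoInDistribution_of_sub_isLittleO`), and `S_n` converges by the multivariate
central limit theorem (`tendstoInDistribution_clt`).

*Covariance.* Products of scores are combinations of `x^r e^{-2ax}`, so the entries of the sample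
covariance matrix are continuous functions of the empirical moments at `A` and at `2A`
(`tendsto_sampleCov_scoreVec`).
-/

namespace LaplaceMoments

/-! ### Elementary inequalities -/

lemma abs_exp_sub_one_le_mul_max (v : ℝ) :
    |Real.exp v - 1| ≤ |v| * max 1 (Real.exp v) := by
  have h1 := Real.add_one_le_exp v
  rcases le_total 0 v with hv | hv
  · have h2 : Real.exp v * Real.exp (-v) = 1 := by rw [← Real.exp_add]; simp
    have h3 := Real.add_one_le_exp (-v)
    have h4 := mul_le_mul_of_nonneg_left h3 (Real.exp_pos v).le
    rw [abs_of_nonneg (by linarith), abs_of_nonneg hv, max_eq_right (Real.one_le_exp hv)]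
    linarith
  · have h2 := Real.exp_le_one_iff.2 hv
    rw [abs_of_nonpos (by linarith), abs_of_nonpos hv, max_eq_left h2]
    linarith

/-- First-order Taylor bound valid for both signs of `v`; the factor `max 1 (exp v)` is what later
lets the weight `exp (-a x)` be traded for `exp (-b x)` with `b` below both `a` and `A`. -/
lemma abs_exp_sub_one_sub_le_sq_mul_max (v : ℝ) :
    |Real.exp v - 1 - v| ≤ v ^ 2 * max 1 (Real.exp v) := by
  have h1 := Real.add_one_le_exp v
  have h2 : Real.exp v * Real.exp (-v) = 1 := by rw [← Real.exp_add]; simp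
  have h3 := Real.add_one_le_exp (-v)
  have h4 := mul_le_mul_of_nonneg_left h3 (Real.exp_pos v).le
  have h5 := abs_exp_sub_one_le_mul_max v
  rw [abs_of_nonneg (by linarith)]
  calc Real.exp v - 1 - v ≤ v * (Real.exp v - 1) := by linarith
    _ ≤ |v| * |Real.exp v - 1| := by rw [← abs_mul]; exact le_abs_self _
    _ ≤ |v| * (|v| * max 1 (Real.exp v)) := by gcongr
    _ = v ^ 2 * max 1 (Real.exp v) := by rw [← mul_assoc, ← sq, sq_abs]

lemma pow_mul_exp_neg_le (r : ℕ) {b x : ℝ} (hb : 0 < b) (hx : 0 ≤ x) :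
    x ^ r * Real.exp (-(b * x)) ≤ r.factorial / b ^ r := by
  have h := Real.pow_div_factorial_le_exp (b * x) (by positivity) r
  rw [div_le_iff₀ (by positivity), mul_pow] at h
  rw [Real.exp_neg, ← div_eq_mul_inv, div_le_div_iff₀ (Real.exp_pos _) (by positivity)]
  linarith

lemma exp_mul_max_le {a A b x : ℝ} (hx : 0 ≤ x) (ha : b ≤ a) (hA : b ≤ A) :
    Real.exp (-(a * x)) * max 1 (Real.exp (-((A - a) * x))) ≤ Real.exp (-(b * x)) := by
  rw [mul_max_of_nonneg _ _ (Real.exp_pos _).le, mul_one, ← Real.exp_add]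
  refine max_le (Real.exp_le_exp.2 ?_) (Real.exp_le_exp.2 ?_)
  · nlinarith
  · nlinarith

lemma abs_pow_mul_exp_sub_le (r : ℕ) {a A b x : ℝ} (hx : 0 ≤ x) (ha : b ≤ a) (hA : b ≤ A) :
    |x ^ r * Real.exp (-(A * x)) - x ^ r * Real.exp (-(a * x))| ≤
      |A - a| * (x ^ (r + 1) * Real.exp (-(b * x))) := by
  have e : Real.exp (-(A * x)) = Real.exp (-(a * x)) * Real.exp (-((A - a) * x)) := by
    rw [← Real.exp_add]; ring_nf
  have h := abs_exp_sub_one_le_mul_max (-((A - a) * x))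
  calc |x ^ r * Real.exp (-(A * x)) - x ^ r * Real.exp (-(a * x))|
      = x ^ r * Real.exp (-(a * x)) * |Real.exp (-((A - a) * x)) - 1| := by
        rw [e, ← abs_of_nonneg (by positivity : 0 ≤ x ^ r * Real.exp (-(a * x))), ← abs_mul,
          abs_of_nonneg (by positivity : 0 ≤ x ^ r * Real.exp (-(a * x)))]
        ring_nf
    _ ≤ x ^ r * Real.exp (-(a * x)) *
        (|-((A - a) * x)| * max 1 (Real.exp (-((A - a) * x)))) := by gcongr
    _ = |A - a| * (x ^ (r + 1) *
        (Real.exp (-(a * x)) * max 1 (Real.exp (-((A - a) * x))))) := by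
        rw [abs_neg, abs_mul, abs_of_nonneg hx]; ring
    _ ≤ _ := by gcongr; exact exp_mul_max_le hx ha hA

lemma abs_pow_mul_exp_taylor_le (r : ℕ) {a A b x : ℝ} (hx : 0 ≤ x) (ha : b ≤ a) (hA : b ≤ A) :
    |x ^ r * Real.exp (-(A * x)) - x ^ r * Real.exp (-(a * x)) +
        (A - a) * (x ^ (r + 1) * Real.exp (-(a * x)))| ≤
      (A - a) ^ 2 * (x ^ (r + 2) * Real.exp (-(b * x))) := by
  have e : Real.exp (-(A * x)) = Real.exp (-(a * x)) * Real.exp (-((A - a) * x)) := by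
    rw [← Real.exp_add]; ring_nf
  have h := abs_exp_sub_one_sub_le_sq_mul_max (-((A - a) * x))
  calc |x ^ r * Real.exp (-(A * x)) - x ^ r * Real.exp (-(a * x)) +
        (A - a) * (x ^ (r + 1) * Real.exp (-(a * x)))|
      = x ^ r * Real.exp (-(a * x)) *
          |Real.exp (-((A - a) * x)) - 1 - (-((A - a) * x))| := by
        rw [e, ← abs_of_nonneg (by positivity : 0 ≤ x ^ r * Real.exp (-(a * x))), ← abs_mul,
          abs_of_nonneg (by positivity : 0 ≤ x ^ r * Real.exp (-(a * x)))]
        ring_nf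
    _ ≤ x ^ r * Real.exp (-(a * x)) *
        ((-((A - a) * x)) ^ 2 * max 1 (Real.exp (-((A - a) * x)))) := by gcongr
    _ = (A - a) ^ 2 * (x ^ (r + 2) *
        (Real.exp (-(a * x)) * max 1 (Real.exp (-((A - a) * x))))) := by ring
    _ ≤ _ := by gcongr; exact exp_mul_max_le hx ha hA

/-! ### Empirical moments of a nonnegative sample -/

lemma empMoment_zero (n : ℕ) (x : ℕ → ℝ) (a : ℝ) : empMoment n x a 0 = empLaplace n x a := by
  simp [empMoment, empLaplace]

lemma abs_sum_div_le {n : ℕ} {f : ℕ → ℝ} {C : ℝ} (hC : 0 ≤ C) (h : ∀ i, |f i| ≤ C) :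
    |(∑ i ∈ Finset.range n, f i) / n| ≤ C := by
  rw [abs_div, Nat.abs_cast]
  refine div_le_of_le_mul₀ (by positivity) hC ?_
  calc _ ≤ ∑ i ∈ Finset.range n, |f i| := Finset.abs_sum_le_sum_abs _ _
    _ ≤ ∑ i ∈ Finset.range n, C := Finset.sum_le_sum fun i _ => h i
    _ = C * n := by simp [mul_comm]

lemma abs_empMoment_sub_le {x : ℕ → ℝ} (hx : ∀ i, 0 ≤ x i) (n r : ℕ) {a A b : ℝ} (hb : 0 < b)
    (ha : b ≤ a) (hA : b ≤ A) :
    |empMoment n x A r - empMoment n x a r| ≤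
      |A - a| * ((r + 1).factorial / b ^ (r + 1)) := by
  rw [empMoment, empMoment, ← sub_div, ← Finset.sum_sub_distrib]
  refine abs_sum_div_le (by positivity) fun i => ?_
  refine (abs_pow_mul_exp_sub_le r (hx i) ha hA).trans ?_
  gcongr
  exact pow_mul_exp_neg_le _ hb (hx i)

lemma abs_empMoment_taylor_le {x : ℕ → ℝ} (hx : ∀ i, 0 ≤ x i) (n r : ℕ) {a A b : ℝ} (hb : 0 < b)
    (ha : b ≤ a) (hA : b ≤ A) :
    |empMoment n x A r - empMoment n x a r + (A - a) * empMoment n x a (r + 1)| ≤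
      (A - a) ^ 2 * ((r + 2).factorial / b ^ (r + 2)) := by
  rw [empMoment, empMoment, empMoment, ← sub_div, ← mul_div_assoc, ← add_div,
    Finset.mul_sum, ← Finset.sum_sub_distrib, ← Finset.sum_add_distrib]
  refine abs_sum_div_le (by positivity) fun i => ?_
  refine (abs_pow_mul_exp_taylor_le r (hx i) ha hA).trans ?_
  gcongr
  exact pow_mul_exp_neg_le _ hb (hx i)

/-- Convergence of an empirical moment at a fixed point passes to a convergent sequence of points,
since the empirical moments are Lipschitz in `a` on `[a/2, ∞)`, uniformly in `n`. -/
lemma tendsto_empMoment {x : ℕ → ℝ} (hx : ∀ i, 0 ≤ x i) (r : ℕ) {a m : ℝ} (ha : 0 < a)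
    {A : ℕ → ℝ} (hA : Tendsto A atTop (𝓝 a))
    (h : Tendsto (fun n => empMoment n x a r) atTop (𝓝 m)) :
    Tendsto (fun n => empMoment n x (A n) r) atTop (𝓝 m) := by
  have hev : ∀ᶠ n in atTop, a / 2 ≤ A n :=
    (hA.eventually (lt_mem_nhds (half_lt_self ha))).mono fun _ => le_of_lt
  have h0 : Tendsto (fun n => empMoment n x (A n) r - empMoment n x a r) atTop (𝓝 0) := by
    refine squeeze_zero_norm' (a := fun n => |A n - a| *
      ((r + 1).factorial / (a / 2) ^ (r + 1))) ?_ ?_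
    · filter_upwards [hev] with n hn
      exact abs_empMoment_sub_le hx n r (half_pos ha) (half_le_self ha.le) hn
    · have := ((hA.sub_const a).abs).mul_const (((r + 1).factorial : ℝ) / (a / 2) ^ (r + 1))
      simpa using this
  simpa using h0.add h

/-! ### The root of the empirical Laplace transform -/

lemma continuous_empLaplace (n : ℕ) (x : ℕ → ℝ) : Continuous (empLaplace n x) := by
  unfold empLaplace
  fun_prop

lemma antitone_empLaplace {x : ℕ → ℝ} (hx : ∀ i, 0 ≤ x i) (n : ℕ) :
    Antitone (empLaplace n x) := by
  intro s t hst
  unfold empLaplace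
  gcongr with i
  exact hx i

lemma empLaplace_at_zero {n : ℕ} (hn : n ≠ 0) (x : ℕ → ℝ) : empLaplace n x 0 = 1 := by
  simp [empLaplace, hn]

/-- If `1/e` is a value of `L_n`, then some observation is positive (otherwise `L_n` is
identically `1`), hence `L_n` is strictly decreasing. -/
lemma strictAnti_empLaplace {x : ℕ → ℝ} (hx : ∀ i, 0 ≤ x i) {n : ℕ} {s₀ : ℝ}
    (h : empLaplace n x s₀ = Real.exp (-1)) : StrictAnti (empLaplace n x) := by
  have hn : n ≠ 0 := by
    rintro rfl
    simp [empLaplace, (Real.exp_pos _).ne] at h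
  obtain ⟨j, hj, hxj⟩ : ∃ j ∈ Finset.range n, 0 < x j := by
    by_contra! hc
    have h1 : empLaplace n x s₀ = 1 := by
      have : ∀ i ∈ Finset.range n, Real.exp (-(s₀ * x i)) = 1 := fun i hi => by
        simp [le_antisymm (hc i hi) (hx i)]
      rw [empLaplace, Finset.sum_congr rfl this]
      simp [hn]
    rw [h1] at h
    have h2 : Real.exp (-1) < 1 := by simp
    exact h2.ne h.symm
  intro s t hst
  unfold empLaplace
  have hn' : (0 : ℝ) < n := by positivity
  refine div_lt_div_of_pos_right (Finset.sum_lt_sum (fun i _ => ?_) ⟨j, hj, ?_⟩) hn'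
  · gcongr
    exact hx i
  · gcongr

lemma empRoot_spec {d : ℝ} {n : ℕ} {x : ℕ → ℝ}
    (h : ∃ s : ℝ, 0 < s ∧ empLaplace n x s = Real.exp (-1)) :
    0 < empRoot d n x ∧ empLaplace n x (empRoot d n x) = Real.exp (-1) := by
  rw [empRoot, dif_pos h]
  exact h.choose_spec

lemma empRoot_eq {x : ℕ → ℝ} (hx : ∀ i, 0 ≤ x i) {d : ℝ} {n : ℕ} {s : ℝ} (hs : 0 < s)
    (h : empLaplace n x s = Real.exp (-1)) : empRoot d n x = s :=
  (strictAnti_empLaplace hx h).injective ((empRoot_spec ⟨s, hs, h⟩).2.trans h.symm)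

lemma exists_empLaplace_eq {n : ℕ} {x : ℕ → ℝ} {s t : ℝ} (hst : s ≤ t)
    (hs : Real.exp (-1) ≤ empLaplace n x s) (ht : empLaplace n x t ≤ Real.exp (-1)) :
    ∃ u ∈ Set.Icc s t, empLaplace n x u = Real.exp (-1) :=
  intermediate_value_Icc' hst (continuous_empLaplace n x).continuousOn ⟨ht, hs⟩

/-- Convergence of `L_n` to a strictly decreasing limit at the rational points is enough to trap
the root between two rationals close to the root of the limit. -/
lemma eventually_exists_root_near {x : ℕ → ℝ} {L : ℝ → ℝ} {a : ℝ} (ha : 0 < a)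
    (hL : StrictAntiOn L (Set.Ici 0)) (hLa : L a = Real.exp (-1))
    (h : ∀ q : ℚ, 0 < q → Tendsto (fun n => empLaplace n x q) atTop (𝓝 (L q)))
    {ε : ℝ} (hε : 0 < ε) :
    ∀ᶠ n in atTop, ∃ s, 0 < s ∧ |s - a| < ε ∧ empLaplace n x s = Real.exp (-1) := by
  obtain ⟨q, hq, hqa⟩ := exists_rat_btwn (max_lt ha (sub_lt_self a hε))
  obtain ⟨t, hat, ht⟩ := exists_rat_btwn (lt_add_of_pos_right a hε)
  have hq0 : (0 : ℝ) < q := (le_max_left _ _).trans_lt hq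
  have hq1 : a - ε < q := (le_max_right _ _).trans_lt hq
  have ht0 : (0 : ℝ) < t := ha.trans hat
  have e1 := (h q (by exact_mod_cast hq0)).eventually
    (lt_mem_nhds (hLa ▸ hL hq0.le ha.le hqa))
  have e2 := (h t (by exact_mod_cast ht0)).eventually
    (gt_mem_nhds (hLa ▸ hL ha.le ht0.le hat))
  filter_upwards [e1, e2] with n h1 h2
  obtain ⟨s, hs, hs'⟩ := exists_empLaplace_eq (hqa.trans hat).le h1.le h2.le
  exact ⟨s, hq0.trans_le hs.1, abs_lt.2 ⟨by linarith [hs.1], by linarith [hs.2]⟩, hs'⟩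

lemma tendsto_empRoot {x : ℕ → ℝ} (hx : ∀ i, 0 ≤ x i) {L : ℝ → ℝ} {a : ℝ} (ha : 0 < a)
    (hL : StrictAntiOn L (Set.Ici 0)) (hLa : L a = Real.exp (-1))
    (h : ∀ q : ℚ, 0 < q → Tendsto (fun n => empLaplace n x q) atTop (𝓝 (L q))) (d : ℕ → ℝ) :
    Tendsto (fun n => empRoot (d n) n x) atTop (𝓝 a) := by
  rw [Metric.tendsto_nhds]
  intro ε hε
  filter_upwards [eventually_exists_root_near ha hL hLa h hε] with n ⟨s, hs, hsa, hs'⟩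
  rwa [empRoot_eq hx hs hs', Real.dist_eq]

lemma existsUnique_root {x : ℕ → ℝ} (hx : ∀ i, 0 ≤ x i) {n : ℕ}
    (h : ∃ s : ℝ, 0 < s ∧ empLaplace n x s = Real.exp (-1)) :
    ∃! s : ℝ, 0 < s ∧ empLaplace n x s = Real.exp (-1) := by
  obtain ⟨s, hs, hs'⟩ := h
  exact ⟨s, ⟨hs, hs'⟩, fun t ht => (strictAnti_empLaplace hx hs').injective (ht.2.trans hs'.symm)⟩

/-! ### Linearization of the estimator -/

open Asymptotics in
/-- First-order expansion of `A ↦ m̂_{r,A}` at `a`, with the empirical derivative `-m̂_{r+1,a}`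
replaced by its limit `-m`. At order `r = 0` it expands the empirical Laplace transform. -/
lemma isLittleO_empMoment_sub_add {x : ℕ → ℝ} (hx : ∀ i, 0 ≤ x i) {a : ℝ} (ha : 0 < a)
    {A : ℕ → ℝ} (hA : Tendsto A atTop (𝓝 a)) (r : ℕ) {m : ℝ}
    (hr : Tendsto (fun n => empMoment n x a (r + 1)) atTop (𝓝 m)) :
    (fun n => empMoment n x (A n) r - empMoment n x a r + m * (A n - a)) =o[atTop]
      (fun n => A n - a) := by
  have hev : ∀ᶠ n in atTop, a / 2 ≤ A n :=
    (hA.eventually (lt_mem_nhds (half_lt_self ha))).mono fun _ => le_of_lt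
  have hδ : Tendsto (fun n => A n - a) atTop (𝓝 0) := by simpa using hA.sub_const a
  have hsq : (fun n => (A n - a) ^ 2) =o[atTop] (fun n => A n - a) := by
    simpa [sq] using (isLittleO_one_iff ℝ |>.2 hδ).mul_isBigO (isBigO_refl (fun n => A n - a) atTop)
  have hT : (fun n => empMoment n x (A n) r - empMoment n x a r +
      (A n - a) * empMoment n x a (r + 1)) =o[atTop] (fun n => A n - a) := by
    refine IsBigO.trans_isLittleO
      (IsBigO.of_bound ((r + 2).factorial / (a / 2) ^ (r + 2) : ℝ) ?_) hsq
    filter_upwards [hev] with n hn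
    rw [Real.norm_eq_abs, Real.norm_eq_abs, abs_sq, mul_comm (_ / _ : ℝ)]
    exact abs_empMoment_taylor_le hx n r (half_pos ha) (half_le_self ha.le) hn
  have hM : (fun n => (m - empMoment n x a (r + 1)) * (A n - a)) =o[atTop]
      (fun n => A n - a) := by
    have : Tendsto (fun n => m - empMoment n x a (r + 1)) atTop (𝓝 0) := by
      simpa using hr.const_sub m
    simpa using (isLittleO_one_iff ℝ |>.2 this).mul_isBigO (isBigO_refl (fun n => A n - a) atTop)
  exact (hT.add hM).congr_left fun n => by ring

open Asymptotics in
/-- The root is asymptotically linear in `U_n = L_n(a) - 1/e`. The expansion of `1/e - L_n(a)` has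
a remainder `o(A - a)`; it forces `A - a = O(U_n)`, so the remainder is `o(U_n)` too. -/
lemma isLittleO_root_sub {x : ℕ → ℝ} (hx : ∀ i, 0 ≤ x i) {a m : ℝ} (ha : 0 < a) (hm : 0 < m)
    {A : ℕ → ℝ} (hA : Tendsto A atTop (𝓝 a))
    (hroot : ∀ᶠ n in atTop, empLaplace n x (A n) = Real.exp (-1))
    (h1 : Tendsto (fun n => empMoment n x a 1) atTop (𝓝 m)) :
    (fun n => (A n - a) - (empLaplace n x a - Real.exp (-1)) / m) =o[atTop]
        (fun n => empLaplace n x a - Real.exp (-1)) ∧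
      (fun n => A n - a) =O[atTop] (fun n => empLaplace n x a - Real.exp (-1)) := by
  have key : (fun n => (A n - a) - (empLaplace n x a - Real.exp (-1)) / m) =o[atTop]
      (fun n => A n - a) := by
    refine ((isLittleO_empMoment_sub_add hx ha hA 0 h1).const_mul_left m⁻¹).congr' ?_ .rfl
    filter_upwards [hroot] with n hn
    rw [empMoment_zero, empMoment_zero, hn]
    field_simp
    ring
  have hO : (fun n => A n - a) =O[atTop] (fun n => empLaplace n x a - Real.exp (-1)) := by
    have h3 : (fun n => A n - a) =O[atTop]
        (fun n => (empLaplace n x a - Real.exp (-1)) / m) :=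
      key.right_isBigO_sub.congr_right fun n => by ring
    refine h3.trans ?_
    simp_rw [div_eq_inv_mul]
    exact isBigO_const_mul_self _ _ _
  exact ⟨key.trans_isBigO hO, hO⟩

open Asymptotics in
/-- Replacing `a` by the root `A` in an empirical moment contributes `-(m_{r+1} / m_1) U_n`, where
`U_n = L_n(a) - 1/e`, up to `o(U_n)`. -/
lemma isLittleO_empMoment_sub {x : ℕ → ℝ} (hx : ∀ i, 0 ≤ x i) {a m : ℝ} (ha : 0 < a) (hm : 0 < m)
    {A : ℕ → ℝ} (hA : Tendsto A atTop (𝓝 a))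
    (hroot : ∀ᶠ n in atTop, empLaplace n x (A n) = Real.exp (-1))
    (h1 : Tendsto (fun n => empMoment n x a 1) atTop (𝓝 m)) (r : ℕ) {m' : ℝ}
    (hr : Tendsto (fun n => empMoment n x a (r + 1)) atTop (𝓝 m')) :
    (fun n => (empMoment n x (A n) r - empMoment n x a r) +
        m' / m * (empLaplace n x a - Real.exp (-1))) =o[atTop]
      (fun n => empLaplace n x a - Real.exp (-1)) := by
  obtain ⟨hlin, hO⟩ := isLittleO_root_sub hx ha hm hA hroot h1
  refine (((isLittleO_empMoment_sub_add hx ha hA r hr).trans_isBigO hO).sub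
    (hlin.const_mul_left m')).congr_left fun n => ?_
  field_simp
  ring

/-! ### The plug-in covariance matrix -/

lemma scoreVec_castSucc (k : ℕ) (m : ℕ → ℝ) (a x : ℝ) (r : Fin k) :
    scoreVec k m a x r.castSucc =
      Real.exp (-(a * x)) * (x ^ (r.val + 1) - m (r + 2) / m 1) := by
  simp [scoreVec, vec]

lemma scoreVec_last (k : ℕ) (m : ℕ → ℝ) (a x : ℝ) :
    scoreVec k m a x (Fin.last k) = Real.exp (-(a * x)) / m 1 := by
  simp [scoreVec, vec]

/-- Every coordinate of the score vector has the form `α x^e e^{-ax} - β(m) e^{-ax}`, where `β` is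
a function of the moments that is continuous where `m 1 ≠ 0`. This treats the coordinates `V_r` (`α = 1`, `e = r`) and `W`
(`α = 0`) alike; the factor `x ^ 0` makes both terms moment integrands. -/
lemma exists_scoreVec_apply_eq (k : ℕ) (p : Fin (k + 1)) :
    ∃ (α : ℝ) (e : ℕ) (β : (ℕ → ℝ) → ℝ), (∀ m, m 1 ≠ 0 → ContinuousAt β m) ∧
      ∀ m a x, scoreVec k m a x p =
        α * (x ^ e * Real.exp (-(a * x))) - β m * (x ^ 0 * Real.exp (-(a * x))) := by
  induction p using Fin.lastCases with
  | last =>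
    refine ⟨0, 0, fun m => -(m 1)⁻¹, fun m hm => ?_, fun m a x => ?_⟩
    · exact ((continuous_apply 1).continuousAt.inv₀ hm).neg
    · rw [scoreVec_last]
      ring
  | cast r =>
    refine ⟨1, r + 1, fun m => m (r + 2) / m 1, fun m hm => ?_, fun m a x => ?_⟩
    · exact (continuous_apply (r.val + 2)).continuousAt.div (continuous_apply 1).continuousAt hm
    · rw [scoreVec_castSucc]
      ring

lemma sampleCov_apply {ι : Type*} {n : ℕ} (hn : n ≠ 0) (z : ℕ → EuclideanSpace ℝ ι) (p q : ι) :
    sampleCov n z p q = (n : ℝ) / (n - 1) * ((∑ i ∈ Finset.range n, z i p * z i q) / n -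
      (∑ i ∈ Finset.range n, z i p) / n * ((∑ i ∈ Finset.range n, z i q) / n)) := by
  have hn' : (n : ℝ) ≠ 0 := Nat.cast_ne_zero.2 hn
  rw [sampleCov, Matrix.of_apply, ← mul_div_right_comm]
  refine congrArg (· / ((n : ℝ) - 1)) ?_
  simp only [sub_mul, mul_sub, Finset.sum_sub_distrib, ← Finset.mul_sum, ← Finset.sum_mul,
    Finset.sum_const, Finset.card_range, nsmul_eq_mul]
  field_simp
  ring

lemma sum_affine_div (n : ℕ) (x : ℕ → ℝ) (a α β : ℝ) (e : ℕ) :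
    (∑ i ∈ Finset.range n, (α * (x i ^ e * Real.exp (-(a * x i))) -
        β * (x i ^ 0 * Real.exp (-(a * x i))))) / n =
      α * empMoment n x a e - β * empMoment n x a 0 := by
  simp only [empMoment, Finset.sum_sub_distrib, ← Finset.mul_sum]
  ring

/-- Products of two score coordinates are moment integrands at `2a`, which is why the empirical
covariances are governed by the empirical moments at `2A`. -/
lemma affine_mul_affine (x a α β α' β' : ℝ) (e e' : ℕ) :
    (α * (x ^ e * Real.exp (-(a * x))) - β * (x ^ 0 * Real.exp (-(a * x)))) *
        (α' * (x ^ e' * Real.exp (-(a * x))) - β' * (x ^ 0 * Real.exp (-(a * x)))) =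
      α * α' * (x ^ (e + e') * Real.exp (-(2 * a * x)))
        - α * β' * (x ^ e * Real.exp (-(2 * a * x)))
        - β * α' * (x ^ e' * Real.exp (-(2 * a * x)))
        + β * β' * (x ^ 0 * Real.exp (-(2 * a * x))) := by
  have : Real.exp (-(2 * a * x)) = Real.exp (-(a * x)) * Real.exp (-(a * x)) := by
    rw [← Real.exp_add]; ring_nf
  rw [this]
  ring

lemma sum_affine_mul_affine_div (n : ℕ) (x : ℕ → ℝ) (a α β α' β' : ℝ) (e e' : ℕ) :
    (∑ i ∈ Finset.range n,
      (α * (x i ^ e * Real.exp (-(a * x i))) - β * (x i ^ 0 * Real.exp (-(a * x i)))) *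
        (α' * (x i ^ e' * Real.exp (-(a * x i))) - β' * (x i ^ 0 * Real.exp (-(a * x i))))) / n =
      α * α' * empMoment n x (2 * a) (e + e') - α * β' * empMoment n x (2 * a) e
        - β * α' * empMoment n x (2 * a) e' + β * β' * empMoment n x (2 * a) 0 := by
  simp only [affine_mul_affine, empMoment, Finset.sum_sub_distrib, Finset.sum_add_distrib,
    ← Finset.mul_sum]
  ring

/-! ### Population moments -/

lemma moment_order_zero {Ω : Type*} [MeasurableSpace Ω] (P : Measure Ω) (X : Ω → ℝ) (a : ℝ) :
    moment P X a 0 = laplace P X a := by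
  simp [moment, laplace]

section Population

variable {Ω : Type*} [MeasurableSpace Ω] {P : Measure Ω} [IsProbabilityMeasure P] {X : Ω → ℝ}

lemma memLp_pow_mul_exp (hX : AEMeasurable X P) (h0 : ∀ᵐ ω ∂P, 0 ≤ X ω) {b : ℝ} (hb : 0 < b)
    (r : ℕ) (q : ENNReal) : MemLp (fun ω => X ω ^ r * Real.exp (-(b * X ω))) q P := by
  refine MemLp.of_bound (by fun_prop) (r.factorial / b ^ r) ?_
  filter_upwards [h0] with ω hω
  rw [Real.norm_of_nonneg (by positivity)]
  exact pow_mul_exp_neg_le r hb hω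

lemma integrable_pow_mul_exp (hX : AEMeasurable X P) (h0 : ∀ᵐ ω ∂P, 0 ≤ X ω) {b : ℝ}
    (hb : 0 < b) (r : ℕ) : Integrable (fun ω => X ω ^ r * Real.exp (-(b * X ω))) P :=
  memLp_one_iff_integrable.1 (memLp_pow_mul_exp hX h0 hb r 1)

lemma exp_neg_mul_le_one {s x : ℝ} (hs : 0 ≤ s) (hx : 0 ≤ x) : Real.exp (-(s * x)) ≤ 1 :=
  Real.exp_le_one_iff.2 (neg_nonpos.2 (mul_nonneg hs hx))

lemma integrable_exp_neg_mul (hX : AEMeasurable X P) (h0 : ∀ᵐ ω ∂P, 0 ≤ X ω) {s : ℝ}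
    (hs : 0 ≤ s) : Integrable (fun ω => Real.exp (-(s * X ω))) P := by
  refine Integrable.of_bound (by fun_prop) 1 ?_
  filter_upwards [h0] with ω hω
  rw [Real.norm_of_nonneg (by positivity)]
  exact exp_neg_mul_le_one hs hω

lemma continuousOn_laplace (hX : AEMeasurable X P) (h0 : ∀ᵐ ω ∂P, 0 ≤ X ω) :
    ContinuousOn (laplace P X) (Set.Ici 0) := by
  refine continuousOn_of_dominated (bound := fun _ => 1) (fun s _ => by fun_prop) (fun s hs => ?_)
    (integrable_const _) (ae_of_all _ fun ω => by fun_prop)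
  filter_upwards [h0] with ω hω
  rw [Real.norm_of_nonneg (by positivity)]
  exact exp_neg_mul_le_one hs hω

lemma tendsto_laplace_atTop (hX : AEMeasurable X P) (h0 : ∀ᵐ ω ∂P, 0 ≤ X ω) :
    Tendsto (laplace P X) atTop (𝓝 (P.real {ω | X ω = 0})) := by
  have hms : NullMeasurableSet {ω | X ω = 0} P :=
    hX.nullMeasurableSet_preimage (measurableSet_singleton 0)
  have : P.real {ω | X ω = 0} = ∫ ω, Set.indicator {ω | X ω = 0} 1 ω ∂P := by
    rw [integral_indicator₀ hms]
    simp
  rw [this]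
  refine tendsto_integral_filter_of_dominated_convergence (fun _ => 1)
    (Eventually.of_forall fun s => by fun_prop) ?_ (integrable_const _) ?_
  · filter_upwards [eventually_ge_atTop 0] with s hs
    filter_upwards [h0] with ω hω
    rw [Real.norm_of_nonneg (by positivity)]
    exact exp_neg_mul_le_one hs hω
  · filter_upwards [h0] with ω hω
    rcases hω.eq_or_lt with h | h
    · simp [← h]
    · rw [Set.indicator_of_notMem (by simpa using h.ne')]
      exact Real.tendsto_exp_neg_atTop_nhds_zero.comp (tendsto_id.atTop_mul_const h)

lemma measure_pos_ne_zero (h0 : ∀ᵐ ω ∂P, 0 ≤ X ω)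
    (hp : P.real {ω | X ω = 0} < Real.exp (-1)) : P {ω | 0 < X ω} ≠ 0 := by
  intro h
  have h1 : ∀ᵐ ω ∂P, X ω = 0 := by
    have h2 : ∀ᵐ ω ∂P, ¬ 0 < X ω := by simpa [ae_iff] using h
    filter_upwards [h0, h2] with ω h3 h4
    exact le_antisymm (not_lt.1 h4) h3
  have h2 : P.real {ω | X ω = 0} = 1 := by
    have : {ω | X ω = 0} =ᵐ[P] Set.univ := eventuallyEq_univ.2 h1
    simp [measureReal_congr this]
  have h3 : Real.exp (-1) < 1 := by simp
  linarith

lemma strictAntiOn_laplace (hX : AEMeasurable X P) (h0 : ∀ᵐ ω ∂P, 0 ≤ X ω)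
    (hp : P.real {ω | X ω = 0} < Real.exp (-1)) : StrictAntiOn (laplace P X) (Set.Ici 0) := by
  intro s hs t ht hst
  rw [laplace, laplace, ← sub_pos, ← integral_sub (integrable_exp_neg_mul hX h0 hs)
    (integrable_exp_neg_mul hX h0 ht), integral_pos_iff_support_of_nonneg_ae ?_
    ((integrable_exp_neg_mul hX h0 hs).sub' (integrable_exp_neg_mul hX h0 ht))]
  · refine pos_iff_ne_zero.2 fun h =>
      measure_pos_ne_zero h0 hp (measure_mono_null (fun ω hω => ?_) h)
    have hω : 0 < X ω := hω
    refine (sub_pos.2 ?_).ne'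
    gcongr
  · filter_upwards [h0] with ω hω
    refine sub_nonneg.2 ?_
    gcongr

lemma exists_laplace_eq (hX : AEMeasurable X P) (h0 : ∀ᵐ ω ∂P, 0 ≤ X ω)
    (hp : P.real {ω | X ω = 0} < Real.exp (-1)) :
    ∃ s ∈ Set.Ici (0 : ℝ), laplace P X s = Real.exp (-1) := by
  obtain ⟨t, ht, ht0⟩ := (((tendsto_laplace_atTop hX h0).eventually (gt_mem_nhds hp)).and
    (eventually_ge_atTop 0)).exists
  have h1 : laplace P X 0 = 1 := by simp [laplace]
  have h2 : Real.exp (-1) ≤ 1 := by simp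
  obtain ⟨s, hs, hs'⟩ := intermediate_value_Icc' ht0
    ((continuousOn_laplace hX h0).mono Set.Icc_subset_Ici_self) ⟨ht.le, h1 ▸ h2⟩
  exact ⟨s, hs.1, hs'⟩

lemma laplace_aStar (hX : AEMeasurable X P) (h0 : ∀ᵐ ω ∂P, 0 ≤ X ω)
    (hp : P.real {ω | X ω = 0} < Real.exp (-1)) :
    laplace P X (aStar P X) = Real.exp (-1) :=
  Function.invFunOn_eq (exists_laplace_eq hX h0 hp)

lemma aStar_pos (hX : AEMeasurable X P) (h0 : ∀ᵐ ω ∂P, 0 ≤ X ω)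
    (hp : P.real {ω | X ω = 0} < Real.exp (-1)) : 0 < aStar P X := by
  have h1 : 0 ≤ aStar P X := Function.invFunOn_mem (exists_laplace_eq hX h0 hp)
  refine h1.lt_of_ne fun h => ?_
  have h2 := laplace_aStar hX h0 hp
  have h3 : laplace P X 0 = 1 := by simp [laplace]
  have h4 : Real.exp (-1) < 1 := by simp
  rw [← h, h3] at h2
  exact h4.ne h2.symm

lemma moment_one_pos (hX : AEMeasurable X P) (h0 : ∀ᵐ ω ∂P, 0 ≤ X ω)
    (hp : P.real {ω | X ω = 0} < Real.exp (-1)) {a : ℝ} (ha : 0 < a) : 0 < moment P X a 1 := by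
  rw [moment, integral_pos_iff_support_of_nonneg_ae ?_ (integrable_pow_mul_exp hX h0 ha 1)]
  · refine pos_iff_ne_zero.2 fun h => measure_pos_ne_zero h0 hp (measure_mono_null ?_ h)
    intro ω hω
    have hω : 0 < X ω := hω
    simp [hω.ne']
  · filter_upwards [h0] with ω hω
    simp only [Pi.zero_apply]
    positivity

lemma integral_affine (hX : AEMeasurable X P) (h0 : ∀ᵐ ω ∂P, 0 ≤ X ω) {a : ℝ} (ha : 0 < a)
    (α β : ℝ) (e : ℕ) :
    ∫ ω, (α * (X ω ^ e * Real.exp (-(a * X ω))) - β * (X ω ^ 0 * Real.exp (-(a * X ω)))) ∂P =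
      α * moment P X a e - β * moment P X a 0 := by
  have h := integrable_pow_mul_exp hX h0 ha
  rw [integral_sub ((h e).const_mul α) ((h 0).const_mul β), integral_const_mul,
    integral_const_mul]
  rfl

lemma integral_affine_mul_affine (hX : AEMeasurable X P) (h0 : ∀ᵐ ω ∂P, 0 ≤ X ω) {a : ℝ}
    (ha : 0 < a) (α β α' β' : ℝ) (e e' : ℕ) :
    ∫ ω, (α * (X ω ^ e * Real.exp (-(a * X ω))) - β * (X ω ^ 0 * Real.exp (-(a * X ω)))) *
        (α' * (X ω ^ e' * Real.exp (-(a * X ω))) - β' * (X ω ^ 0 * Real.exp (-(a * X ω)))) ∂P =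
      α * α' * moment P X (2 * a) (e + e') - α * β' * moment P X (2 * a) e
        - β * α' * moment P X (2 * a) e' + β * β' * moment P X (2 * a) 0 := by
  have h := fun c r => (integrable_pow_mul_exp hX h0 (mul_pos two_pos ha) r).const_mul c
  simp only [affine_mul_affine]
  rw [integral_add (((h _ _).sub' (h _ _)).sub' (h _ _)) (h _ _),
    integral_sub ((h _ _).sub' (h _ _)) (h _ _), integral_sub (h _ _) (h _ _)]
  simp only [integral_const_mul, moment]

lemma memLp_scoreVec_apply (hX : AEMeasurable X P) (h0 : ∀ᵐ ω ∂P, 0 ≤ X ω) {a : ℝ}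
    (ha : 0 < a) (k : ℕ) (m : ℕ → ℝ) (p : Fin (k + 1)) (q : ENNReal) :
    MemLp (fun ω => scoreVec k m a (X ω) p) q P := by
  obtain ⟨α, e, β, -, h⟩ := exists_scoreVec_apply_eq k p
  simp only [h]
  exact ((memLp_pow_mul_exp hX h0 ha e q).const_mul α).sub
    ((memLp_pow_mul_exp hX h0 ha 0 q).const_mul (β m))

/-! ### Limit of the plug-in covariance matrix -/

lemma tendsto_sampleCov_scoreVec (hX : AEMeasurable X P) (h0 : ∀ᵐ ω ∂P, 0 ≤ X ω) {a : ℝ}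
    (ha : 0 < a) (hm : moment P X a 1 ≠ 0) {x : ℕ → ℝ} (hx : ∀ i, 0 ≤ x i)
    (h1 : ∀ r, Tendsto (fun n => empMoment n x a r) atTop (𝓝 (moment P X a r)))
    (h2 : ∀ r, Tendsto (fun n => empMoment n x (2 * a) r) atTop (𝓝 (moment P X (2 * a) r)))
    {A : ℕ → ℝ} (hA : Tendsto A atTop (𝓝 a)) (k : ℕ) :
    Tendsto (fun n => sampleCov n fun i => scoreVec k (empMoment n x (A n)) (A n) (x i)) atTop
      (𝓝 (covMat P fun ω => scoreVec k (moment P X a) a (X ω))) := by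
  refine tendsto_pi_nhds.2 fun p => tendsto_pi_nhds.2 fun q => ?_
  obtain ⟨α, e, β, hβ, hp⟩ := exists_scoreVec_apply_eq k p
  obtain ⟨α', e', β', hβ', hq⟩ := exists_scoreVec_apply_eq k q
  have hA2 : Tendsto (fun n => 2 * A n) atTop (𝓝 (2 * a)) := hA.const_mul 2
  have l1 := fun r => tendsto_empMoment hx r ha hA (h1 r)
  have l2 := fun r => tendsto_empMoment hx r (mul_pos two_pos ha) hA2 (h2 r)
  have lβ := (hβ _ hm).tendsto.comp (tendsto_pi_nhds.2 l1)
  have lβ' := (hβ' _ hm).tendsto.comp (tendsto_pi_nhds.2 l1)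
  have lim : covMat P (fun ω => scoreVec k (moment P X a) a (X ω)) p q = 1 *
      ((α * α' * moment P X (2 * a) (e + e') - α * β' (moment P X a) * moment P X (2 * a) e
        - β (moment P X a) * α' * moment P X (2 * a) e'
        + β (moment P X a) * β' (moment P X a) * moment P X (2 * a) 0) -
      (α * moment P X a e - β (moment P X a) * moment P X a 0) *
        (α' * moment P X a e' - β' (moment P X a) * moment P X a 0)) := by
    rw [covMat, Matrix.of_apply, covariance_eq_sub (memLp_scoreVec_apply hX h0 ha k _ p 2)
      (memLp_scoreVec_apply hX h0 ha k _ q 2)]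
    simp only [Pi.mul_apply, hp, hq]
    rw [integral_affine_mul_affine hX h0 ha, integral_affine hX h0 ha, integral_affine hX h0 ha,
      one_mul]
  rw [lim]
  have hn : Tendsto (fun n : ℕ => (n : ℝ) / (n - 1)) atTop (𝓝 1) := by
    simpa [sub_eq_add_neg] using tendsto_natCast_div_add_atTop (-1 : ℝ)
  refine (hn.mul ((((((l2 (e + e')).const_mul (α * α')).sub ((lβ'.const_mul α).mul (l2 e))).sub
    ((lβ.mul_const α').mul (l2 e'))).add ((lβ.mul lβ').mul (l2 0))).sub
    ((((l1 e).const_mul α).sub (lβ.mul (l1 0))).mul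
      (((l1 e').const_mul α').sub (lβ'.mul (l1 0)))))).congr' ?_
  filter_upwards [eventually_ne_atTop 0] with n hn0
  rw [sampleCov_apply hn0]
  simp only [hp, hq]
  rw [sum_affine_mul_affine_div, sum_affine_div, sum_affine_div]
  rfl

end Population

/-! ### Measurability of the estimators -/

/-- Existence of the root is a countable condition, which makes it a measurable event. -/
lemma exists_root_iff {x : ℕ → ℝ} (hx : ∀ i, 0 ≤ x i) {n : ℕ} (hn : n ≠ 0) :
    (∃ s : ℝ, 0 < s ∧ empLaplace n x s = Real.exp (-1)) ↔
      ∃ N : ℕ, empLaplace n x N ≤ Real.exp (-1) := by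
  have h1 : Real.exp (-1) < 1 := by simp
  constructor
  · rintro ⟨s, -, hs⟩
    obtain ⟨N, hN⟩ := exists_nat_ge s
    exact ⟨N, hs ▸ antitone_empLaplace hx n hN⟩
  · rintro ⟨N, hN⟩
    obtain ⟨s, hs, hs'⟩ := exists_empLaplace_eq (Nat.cast_nonneg N)
      (by rw [empLaplace_at_zero hn]; exact h1.le) hN
    refine ⟨s, hs.1.lt_of_ne ?_, hs'⟩
    rintro rfl
    rw [empLaplace_at_zero hn] at hs'
    exact h1.ne' hs'

lemma empRoot_le_iff {x : ℕ → ℝ} (hx : ∀ i, 0 ≤ x i) {n : ℕ} {d t : ℝ}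
    (h : ∃ s : ℝ, 0 < s ∧ empLaplace n x s = Real.exp (-1)) :
    empRoot d n x ≤ t ↔ 0 < t ∧ empLaplace n x t ≤ Real.exp (-1) := by
  obtain ⟨h1, h2⟩ := empRoot_spec (d := d) h
  rw [← h2, (strictAnti_empLaplace hx h2).le_iff_ge]
  exact ⟨fun h => ⟨h1.trans_le h, h⟩, fun h => h.2⟩

lemma measurable_empLaplace (n : ℕ) (s : ℝ) : Measurable fun x : ℕ → ℝ => empLaplace n x s := by
  unfold empLaplace
  fun_prop

lemma measurable_empRoot {Ω : Type*} [MeasurableSpace Ω] {Y : ℕ → Ω → ℝ}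
    (hY : ∀ i, Measurable (Y i)) (h0 : ∀ i ω, 0 ≤ Y i ω) (d : ℝ) (n : ℕ) :
    Measurable fun ω => empRoot d n (fun i => Y i ω) := by
  -- for `n = 0` the empirical transform is `0` by convention and the root is the constant `d`
  rcases eq_or_ne n 0 with rfl | hn
  · simp [empRoot, empLaplace, (Real.exp_pos _).ne, measurable_const]
  have hL : ∀ s, Measurable fun ω => empLaplace n (fun i => Y i ω) s := fun s =>
    (measurable_empLaplace n s).comp (measurable_pi_lambda _ hY)
  have hE : MeasurableSet {ω | ∃ N : ℕ, empLaplace n (fun i => Y i ω) N ≤ Real.exp (-1)} := by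
    simp only [Set.ofPred_exists]
    exact MeasurableSet.iUnion fun N => measurableSet_le (hL N) measurable_const
  refine measurable_of_Iic fun t => ?_
  convert (hE.inter ((MeasurableSet.const (0 < t)).inter
    (measurableSet_le (hL t) (measurable_const (a := Real.exp (-1)))))).union
    (hE.compl.inter (MeasurableSet.const (d ≤ t))) using 1
  ext ω
  have hr := exists_root_iff (fun i => h0 i ω) hn
  simp only [Set.mem_preimage, Set.mem_Iic, Set.mem_union, Set.mem_inter_iff, Set.mem_ofPred_eq,
    Set.mem_compl_iff]
  by_cases h : ∃ s : ℝ, 0 < s ∧ empLaplace n (fun i => Y i ω) s = Real.exp (-1)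
  · rw [empRoot_le_iff (fun i => h0 i ω) h]
    simp [hr.1 h]
  · rw [empRoot, dif_neg h]
    simp only [hr.not.1 h, not_false_eq_true, false_and, true_and, false_or]

lemma aemeasurable_empRoot {Ω : Type*} [MeasurableSpace Ω] {P : Measure Ω} {Y : ℕ → Ω → ℝ}
    (hY : ∀ i, AEMeasurable (Y i) P) (h0 : ∀ᵐ ω ∂P, ∀ i, 0 ≤ Y i ω) (d : ℝ) (n : ℕ) :
    AEMeasurable (fun ω => empRoot d n (fun i => Y i ω)) P := by
  -- the positive part of a measurable modification is nonnegative at every point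
  refine ⟨fun ω => empRoot d n (fun i => max ((hY i).mk (Y i) ω) 0),
    measurable_empRoot (fun i => (hY i).measurable_mk.max measurable_const)
      (fun i ω => le_max_right _ _) d n, ?_⟩
  filter_upwards [h0, ae_all_iff.2 fun i => (hY i).ae_eq_mk] with ω h1 h2
  congr 1
  ext i
  rw [← h2 i, max_eq_left (h1 i)]

lemma aemeasurable_empMoment {Ω : Type*} [MeasurableSpace Ω] {P : Measure Ω} {Y : ℕ → Ω → ℝ}
    {A : Ω → ℝ} (hY : ∀ i, AEMeasurable (Y i) P) (hA : AEMeasurable A P) (n r : ℕ) :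
    AEMeasurable (fun ω => empMoment n (fun i => Y i ω) (A ω) r) P := by
  unfold empMoment
  fun_prop

lemma vec_castSucc (k : ℕ) (v : ℕ → ℝ) (w : ℝ) (r : Fin k) : vec k v w r.castSucc = v r := by
  simp [vec]

lemma vec_last (k : ℕ) (v : ℕ → ℝ) (w : ℝ) : vec k v w (Fin.last k) = w := by
  simp [vec]

lemma aemeasurable_euclidean {Ω ι : Type*} [MeasurableSpace Ω] {P : Measure Ω} [Fintype ι]
    {Z : Ω → EuclideanSpace ℝ ι} (h : ∀ p, AEMeasurable (fun ω => Z ω p) P) : AEMeasurable Z P :=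
  (WithLp.measurable_toLp 2 (ι → ℝ)).comp_aemeasurable (aemeasurable_pi_lambda _ h)

lemma aemeasurable_vec {Ω : Type*} [MeasurableSpace Ω] {P : Measure Ω} (k : ℕ) {v : Ω → ℕ → ℝ}
    {w : Ω → ℝ} (hv : ∀ r, AEMeasurable (fun ω => v ω r) P) (hw : AEMeasurable w P) :
    AEMeasurable (fun ω => vec k (v ω) (w ω)) P := by
  refine aemeasurable_euclidean fun p => ?_
  induction p using Fin.lastCases with
  | last => simpa only [vec_last] using hw
  | cast r => simpa only [vec_castSucc] using hv r

lemma aemeasurable_scoreVec {Ω : Type*} [MeasurableSpace Ω] {P : Measure Ω} (k : ℕ)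
    {m : Ω → ℕ → ℝ} {A Y : Ω → ℝ} (hm : ∀ r, AEMeasurable (fun ω => m ω r) P)
    (hA : AEMeasurable A P) (hY : AEMeasurable Y P) :
    AEMeasurable (fun ω => scoreVec k (m ω) (A ω) (Y ω)) P :=
  aemeasurable_vec k (fun r => by have := hm (r + 2); have := hm 1; fun_prop)
    (by have := hm 1; fun_prop)

lemma aemeasurable_estimator {Ω : Type*} [MeasurableSpace Ω] {P : Measure Ω} {Y : ℕ → Ω → ℝ}
    (hY : ∀ i, AEMeasurable (Y i) P) (h0 : ∀ᵐ ω ∂P, ∀ i, 0 ≤ Y i ω) (k : ℕ) (d : ℝ) (n : ℕ) :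
    AEMeasurable (fun ω => estimator k d n (fun i => Y i ω)) P :=
  aemeasurable_vec k (fun r => aemeasurable_empMoment hY (aemeasurable_empRoot hY h0 d n) n (r + 1))
    (aemeasurable_empRoot hY h0 d n)

lemma aemeasurable_covEstimator {Ω : Type*} [MeasurableSpace Ω] {P : Measure Ω} {Y : ℕ → Ω → ℝ}
    (hY : ∀ i, AEMeasurable (Y i) P) (h0 : ∀ᵐ ω ∂P, ∀ i, 0 ≤ Y i ω) (k : ℕ) (d : ℝ) (n : ℕ)
    (p q : Fin (k + 1)) :
    AEMeasurable (fun ω => covEstimator k d n (fun i => Y i ω) p q) P := by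
  have hA := aemeasurable_empRoot hY h0 d n
  have h : ∀ i p, AEMeasurable (fun ω => scoreVec k
      (empMoment n (fun i => Y i ω) (empRoot d n (fun i => Y i ω)))
      (empRoot d n (fun i => Y i ω)) (Y i ω) p) P := fun i p =>
    (by fun_prop : Measurable fun z : EuclideanSpace ℝ (Fin (k + 1)) => z p).comp_aemeasurable
      (aemeasurable_scoreVec k (fun r => aemeasurable_empMoment hY hA n r) hA (hY i))
  simp only [covEstimator, sampleCov, Matrix.of_apply]
  fun_prop

lemma measurable_scoreVec (k : ℕ) (m : ℕ → ℝ) (a : ℝ) : Measurable (scoreVec k m a) := by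
  refine (WithLp.measurable_toLp 2 _).comp (measurable_pi_lambda _ fun p => ?_)
  induction p using Fin.lastCases with
  | last => simp only [Fin.snoc_last]; fun_prop
  | cast r => simp only [Fin.snoc_castSucc]; fun_prop

/-! ### Weak convergence -/

/-- If `Y n - S n = o(S n)` almost surely, then `Y n` inherits the limit law of `S n`. The
difference eventually equals `‖S n‖ • Q n` with `Q n → 0` almost surely, so that Slutsky's theorem
applies and no tightness estimate is needed. -/
lemma tendstoInDistribution_of_sub_isLittleO {Ω Ω' E : Type*} [MeasurableSpace Ω]
    [MeasurableSpace Ω'] {P : Measure Ω} [IsProbabilityMeasure P] {P' : Measure Ω'}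
    [IsProbabilityMeasure P'] [NormedAddCommGroup E] [NormedSpace ℝ E] [MeasurableSpace E]
    [BorelSpace E] [SecondCountableTopology E] {S Y : ℕ → Ω → E} {Z : Ω' → E}
    (hS : TendstoInDistribution S atTop Z (fun _ => P) P') (hY : ∀ n, AEMeasurable (Y n) P)
    (h : ∀ᵐ ω ∂P, (fun n => Y n ω - S n ω) =o[atTop] fun n => S n ω) :
    TendstoInDistribution Y atTop Z (fun _ => P) P' := by
  have hSm := hS.forall_aemeasurable
  set Q : ℕ → Ω → E := fun n ω => ‖S n ω‖⁻¹ • (Y n ω - S n ω) with hQ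
  have hQm : ∀ n, AEMeasurable (Q n) P := fun n => by
    have := hY n
    have := hSm n
    fun_prop
  have hQ0 : ∀ᵐ ω ∂P, Tendsto (fun n => Q n ω) atTop (𝓝 0) := by
    filter_upwards [h] with ω hω
    refine tendsto_zero_iff_norm_tendsto_zero.2 ?_
    simpa [hQ, norm_smul, div_eq_inv_mul] using
      (Asymptotics.isLittleO_norm_norm.2 hω).tendsto_div_nhds_zero
  have hg : TendstoInDistribution (fun n ω => S n ω + ‖S n ω‖ • Q n ω) atTop
      (fun ω => Z ω + ‖Z ω‖ • (0 : E)) (fun _ => P) P' :=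
    hS.continuous_comp_prodMk_of_tendstoInMeasure_const
      (g := fun z : E × E => z.1 + ‖z.1‖ • z.2) (by fun_prop)
      (tendstoInMeasure_of_tendsto_ae (fun n => (hQm n).aestronglyMeasurable) hQ0) hQm
  simp only [smul_zero, add_zero] at hg
  refine tendstoInDistribution_of_tendstoInMeasure_sub Y Z hg ?_ hY
  refine tendstoInMeasure_of_tendsto_ae
    (fun n => ((hY n).sub (hg.forall_aemeasurable n)).aestronglyMeasurable) ?_
  filter_upwards [h] with ω hω
  refine tendsto_const_nhds.congr' ?_
  filter_upwards [hω.bound one_pos] with n hn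
  -- where `S n ω = 0`, the little-o bound forces `Y n ω = 0`
  rcases eq_or_ne (S n ω) 0 with h0 | h0
  · have : Y n ω = 0 := by simpa [h0] using hn
    simp [h0, this]
  · simp [hQ, smul_smul, norm_ne_zero_iff.2 h0]

lemma variance_sum_mul_eq {Ω ι : Type*} [MeasurableSpace Ω] {P : Measure Ω}
    [IsProbabilityMeasure P] [Fintype ι] {Z : Ω → EuclideanSpace ℝ ι}
    (hZ : ∀ p, MemLp (fun ω => Z ω p) 2 P) (t : ι → ℝ) :
    Var[fun ω => ∑ p, t p * Z ω p; P] = t ⬝ᵥ (covMat P Z).mulVec t := by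
  have hm : ∀ p, MemLp (fun ω => t p * Z ω p) 2 P := fun p => (hZ p).const_mul _
  rw [← covariance_self (memLp_finsetSum _ fun p _ => hm p).aestronglyMeasurable.aemeasurable,
    covariance_fun_sum_fun_sum hm hm]
  simp only [covariance_const_mul_left, covariance_const_mul_right, dotProduct, Matrix.mulVec,
    covMat, Matrix.of_apply, Finset.mul_sum]
  exact Finset.sum_congr rfl fun p _ => Finset.sum_congr rfl fun q _ => by ring

lemma posSemidef_covMat {Ω ι : Type*} [MeasurableSpace Ω] {P : Measure Ω}
    [IsProbabilityMeasure P] [Fintype ι] {Z : Ω → EuclideanSpace ℝ ι}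
    (hZ : ∀ p, MemLp (fun ω => Z ω p) 2 P) : (covMat P Z).PosSemidef := by
  refine Matrix.PosSemidef.of_dotProduct_mulVec_nonneg ?_ fun t => ?_
  · ext p q
    simp [covMat, covariance_comm]
  · rw [star_trivial, ← variance_sum_mul_eq hZ]
    exact variance_nonneg _ _

/-- The central limit theorem in `ℝ^ι`, from the one-dimensional theorem by the Cramér-Wold
device. -/
lemma tendstoInDistribution_clt {Ω Ω₀ ι : Type*} [MeasurableSpace Ω] [MeasurableSpace Ω₀]
    {P : Measure Ω} [IsProbabilityMeasure P] {P₀ : Measure Ω₀} [IsProbabilityMeasure P₀]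
    [Fintype ι] [DecidableEq ι] {Z : ℕ → Ω → EuclideanSpace ℝ ι} {Z₀ : Ω₀ → EuclideanSpace ℝ ι}
    (hind : iIndepFun Z P) (hid : ∀ i, IdentDistrib (Z i) Z₀ P P₀)
    (hZ : ∀ p, MemLp (fun ω => Z₀ ω p) 2 P₀) :
    TendstoInDistribution
      (fun (n : ℕ) ω => (√(n : ℝ))⁻¹ •
        (∑ i ∈ Finset.range n, Z i ω - (n : ℝ) • WithLp.toLp 2 fun p => ∫ ω, Z₀ ω p ∂P₀))
      atTop id (fun _ => P) (multivariateGaussian 0 (covMat P₀ Z₀)) where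
  forall_aemeasurable n := by
    have := fun i => (hid i).aemeasurable_fst
    fun_prop
  aemeasurable_limit := aemeasurable_id
  tendsto := by
    refine ProbabilityMeasure.tendsto_iff_tendsto_charFun.2 fun t => ?_
    have hu : Measurable fun z : EuclideanSpace ℝ ι => ∑ p, t p * z p := by fun_prop
    have hid1 : ∀ i, IdentDistrib (fun ω => ∑ p, t p * Z i ω p) (fun ω => ∑ p, t p * Z₀ ω p) P P₀ :=
      fun i => (hid i).comp hu
    have hvar : Var[fun ω => ∑ p, t p * Z 0 ω p; P] = t ⬝ᵥ (covMat P₀ Z₀).mulVec t := by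
      rw [(hid1 0).variance_eq, variance_sum_mul_eq hZ]
    have hL2 : MemLp (fun ω => ∑ p, t p * Z 0 ω p) 2 P :=
      (hid1 0).memLp_iff.2 (memLp_finsetSum _ fun p _ => (hZ p).const_mul _)
    have hmean : ∫ ω, ∑ p, t p * Z 0 ω p ∂P = ∑ p, t p * ∫ ω, Z₀ ω p ∂P₀ := by
      rw [(hid1 0).integral_eq, integral_finsetSum _ fun p _ =>
        ((hZ p).integrable one_le_two).const_mul _]
      simp only [integral_const_mul]
    have clt := tendstoInDistribution_inv_sqrt_mul_sum_sub (X := fun i ω => ∑ p, t p * Z i ω p)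
      (P := P) (Y := id)
      (P' := gaussianReal 0 Var[fun ω => ∑ p, t p * Z 0 ω p; P].toNNReal) ⟨by fun_prop, by simp⟩
      hL2 (hind.comp (fun _ z => ∑ p, t p * z p) fun _ => hu)
      (fun i => (hid1 i).trans (hid1 0).symm)
    -- the characteristic function of a vector at `t` is that of its product with `t` at `1`
    have h1 := ProbabilityMeasure.tendsto_iff_tendsto_charFun.1 clt.tendsto 1
    have e2 : charFun (multivariateGaussian 0 (covMat P₀ Z₀)) t =
        charFun (gaussianReal 0 Var[fun ω => ∑ p, t p * Z 0 ω p; P].toNNReal) 1 := by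
      rw [charFun_multivariateGaussian (posSemidef_covMat hZ), charFun_gaussianReal, hvar,
        Real.coe_toNNReal]
      · simp
      · rw [← hvar]
        exact variance_nonneg _ _
    simp only [ProbabilityMeasure.coe_mk, Measure.map_id] at h1 ⊢
    rw [e2]
    refine h1.congr fun n => ?_
    have hm := fun i => (hid i).aemeasurable_fst
    rw [charFun_apply, charFun_apply, integral_map (by fun_prop) (by fun_prop),
      integral_map (by fun_prop) (by fun_prop)]
    refine integral_congr_ae (ae_of_all _ fun ω => ?_)
    have : inner ℝ ((√(n : ℝ))⁻¹ •
        (∑ i ∈ Finset.range n, Z i ω - (n : ℝ) • WithLp.toLp 2 fun p => ∫ ω, Z₀ ω p ∂P₀)) t =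
        (√(n : ℝ))⁻¹ * (∑ i ∈ Finset.range n, ∑ p, t p * Z i ω p -
          n * ∫ ω, ∑ p, t p * Z 0 ω p ∂P) := by
      rw [real_inner_smul_left, inner_sub_left, real_inner_smul_left, sum_inner, hmean]
      simp [PiLp.inner_apply]
    simp only
    rw [this]
    simp

/-! ### Independent copies -/

lemma ae_tendsto_empMoment {Ω Ω₀ : Type*} [MeasurableSpace Ω] [MeasurableSpace Ω₀]
    {P : Measure Ω} {P₀ : Measure Ω₀} [IsProbabilityMeasure P₀]
    {X : Ω₀ → ℝ} {Xs : ℕ → Ω → ℝ} (h0 : ∀ᵐ ω ∂P₀, 0 ≤ X ω) (hind : iIndepFun Xs P)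
    (hid : ∀ i, IdentDistrib (Xs i) X P P₀) {b : ℝ} (hb : 0 < b) (r : ℕ) :
    ∀ᵐ ω ∂P, Tendsto (fun n => empMoment n (fun i => Xs i ω) b r) atTop (𝓝 (moment P₀ X b r)) := by
  have hu : Measurable fun x : ℝ => x ^ r * Real.exp (-(b * x)) := by fun_prop
  have hid1 := fun i => (hid i).comp hu
  have h := strong_law_ae_real (μ := P) (fun i ω => Xs i ω ^ r * Real.exp (-(b * Xs i ω)))
    ((hid1 0).integrable_iff.2 (integrable_pow_mul_exp (hid 0).aemeasurable_snd h0 hb r))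
    (fun i j hij => (hind.indepFun hij).comp hu hu)
    (fun i => (hid1 i).trans (hid1 0).symm)
  have e : ∫ ω, Xs 0 ω ^ r * Real.exp (-(b * Xs 0 ω)) ∂P = moment P₀ X b r := (hid1 0).integral_eq
  rwa [e] at h

lemma inv_sqrt_mul_sum_sub {n : ℕ} (hn : n ≠ 0) (f : ℕ → ℝ) (c : ℝ) :
    (√(n : ℝ))⁻¹ * (∑ i ∈ Finset.range n, f i - n * c) =
      √(n : ℝ) * ((∑ i ∈ Finset.range n, f i) / n - c) := by
  have h : (0 : ℝ) < n := by positivity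
  have h2 : √(n : ℝ) ≠ 0 := (Real.sqrt_pos.2 h).ne'
  have h3 := Real.sq_sqrt h.le
  field_simp
  rw [h3]

open Asymptotics in
lemma isLittleO_euclidean {ι F : Type*} [Fintype ι] [NormedAddCommGroup F]
    {f : ℕ → EuclideanSpace ℝ ι} {g : ℕ → F} (h : ∀ p, (fun n => f n p) =o[atTop] g) :
    f =o[atTop] g :=
  IsBigO.trans_isLittleO
    (((PiLp.continuousLinearEquiv 2 ℝ (fun _ : ι => ℝ)).symm.toContinuousLinearMap).isBigO_comp
      (fun n p => f n p) atTop) (isLittleO_pi.2 h)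

open Asymptotics in
/-- The normalized estimation error is the normalized centred sum of the score vectors, up to an
error negligible with respect to that sum: with `U_n = L_n(a) - 1/e`, all remainders are
`o(√n U_n)`, and `√n U_n / m_1` is the last coordinate of the sum. -/
lemma isLittleO_estimator_sub {x : ℕ → ℝ} (hx : ∀ i, 0 ≤ x i) {a : ℝ} (ha : 0 < a) {m : ℕ → ℝ}
    (hm : 0 < m 1) {d : ℕ → ℝ} (hA : Tendsto (fun n => empRoot (d n) n x) atTop (𝓝 a))
    (hroot : ∀ᶠ n in atTop, empLaplace n x (empRoot (d n) n x) = Real.exp (-1))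
    (h1 : ∀ r, Tendsto (fun n => empMoment n x a r) atTop (𝓝 (m r))) (k : ℕ)
    {c : EuclideanSpace ℝ (Fin (k + 1))}
    (hc : ∀ r : Fin k, c r.castSucc = m (r + 1) - m (r + 2) / m 1 * Real.exp (-1))
    (hc' : c (Fin.last k) = Real.exp (-1) / m 1) :
    (fun n : ℕ => √(n : ℝ) • (estimator k (d n) n x - paramVec k m a) -
        (√(n : ℝ))⁻¹ • (∑ i ∈ Finset.range n, scoreVec k m a (x i) - (n : ℝ) • c)) =o[atTop]
      fun n : ℕ => (√(n : ℝ))⁻¹ • (∑ i ∈ Finset.range n, scoreVec k m a (x i) - (n : ℝ) • c) := by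
  set S := fun n : ℕ => (√(n : ℝ))⁻¹ •
    (∑ i ∈ Finset.range n, scoreVec k m a (x i) - (n : ℝ) • c) with hS
  have hlast : ∀ n : ℕ, n ≠ 0 → S n (Fin.last k) =
      √(n : ℝ) * ((empLaplace n x a - Real.exp (-1)) / m 1) := fun n hn => by
    simp only [hS, PiLp.smul_apply, PiLp.sub_apply, WithLp.ofLp_sum, Finset.sum_apply, smul_eq_mul,
      hc', scoreVec_last]
    rw [inv_sqrt_mul_sum_sub hn, ← Finset.sum_div, empLaplace]
    ring
  have hcast : ∀ n : ℕ, n ≠ 0 → ∀ r : Fin k, S n r.castSucc = √(n : ℝ) *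
      (empMoment n x a (r + 1) - m (r + 1) -
        m (r + 2) / m 1 * (empLaplace n x a - Real.exp (-1))) := fun n hn r => by
    simp only [hS, PiLp.smul_apply, PiLp.sub_apply, WithLp.ofLp_sum, Finset.sum_apply, smul_eq_mul,
      hc, scoreVec_castSucc]
    rw [inv_sqrt_mul_sum_sub hn, empLaplace, empMoment]
    simp only [mul_sub, Finset.sum_sub_distrib, ← Finset.sum_mul]
    simp only [mul_comm (Real.exp _)]
    ring
  have hU : (fun n : ℕ => √(n : ℝ) * (empLaplace n x a - Real.exp (-1))) =O[atTop] S := by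
    refine IsBigO.of_bound (m 1) ?_
    filter_upwards [eventually_ne_atTop 0] with n hn
    have h2 : √(n : ℝ) * (empLaplace n x a - Real.exp (-1)) = m 1 * S n (Fin.last k) := by
      rw [hlast n hn]
      field_simp
    rw [h2, norm_mul, Real.norm_of_nonneg hm.le]
    gcongr
    exact PiLp.norm_apply_le _ _
  have hsqrt := isBigO_refl (fun n : ℕ => √(n : ℝ)) atTop
  refine isLittleO_euclidean fun p => ?_
  induction p using Fin.lastCases with
  | last =>
    refine ((hsqrt.mul_isLittleO (isLittleO_root_sub hx ha hm hA hroot (h1 1)).1).trans_isBigO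
      hU).congr' ?_ .rfl
    filter_upwards [eventually_ne_atTop 0] with n hn
    rw [PiLp.sub_apply, hlast n hn]
    simp only [estimator, paramVec, PiLp.smul_apply, PiLp.sub_apply, vec_last, smul_eq_mul]
    ring
  | cast r =>
    refine ((hsqrt.mul_isLittleO (isLittleO_empMoment_sub hx ha hm hA hroot (h1 1) (r + 1)
      (h1 (r + 2)))).trans_isBigO hU).congr' ?_ .rfl
    filter_upwards [eventually_ne_atTop 0] with n hn
    rw [PiLp.sub_apply, hcast n hn]
    simp only [estimator, paramVec, PiLp.smul_apply, PiLp.sub_apply, vec_castSucc, smul_eq_mul]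
    ring

end LaplaceMoments

theorem proposition1
    {Ω₀ Ω : Type*} [MeasurableSpace Ω₀] [MeasurableSpace Ω]
    (P₀ : Measure Ω₀) [IsProbabilityMeasure P₀] (P : Measure Ω) [IsProbabilityMeasure P]
    (X : Ω₀ → ℝ) (hX_nonneg : ∀ᵐ ω ∂P₀, 0 ≤ X ω)
    (hp : P₀.real {ω | X ω = 0} < Real.exp (-1))
    (Xs : ℕ → Ω → ℝ) (h_indep : iIndepFun Xs P) (h_copies : ∀ i, IdentDistrib (Xs i) X P P₀)
    (k : ℕ) (d : ℕ → ℝ) :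
    -- `a_* > 0` is the unique solution of `L_X(s) = 1/e`
    (0 < aStar P₀ X ∧ laplace P₀ X (aStar P₀ X) = Real.exp (-1) ∧
      ∀ s, 0 ≤ s → laplace P₀ X s = Real.exp (-1) → s = aStar P₀ X) ∧
    -- almost surely, `A` is well defined for large `n`
    (∀ᵐ ω ∂P, ∀ᶠ n in atTop,
      ∃! s : ℝ, 0 < s ∧ empLaplace n (fun i => Xs i ω) s = Real.exp (-1)) ∧
    -- almost sure convergence
    (∀ᵐ ω ∂P, Tendsto (fun n => estimator k (d n) n (fun i => Xs i ω)) atTop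
      (𝓝 (target k P₀ X))) ∧
    -- asymptotic normality
    TendstoInDistribution
      (fun (n : ℕ) ω => √(n : ℝ) • (estimator k (d n) n (fun i => Xs i ω) - target k P₀ X))
      atTop id (fun _ => P) (multivariateGaussian 0 (asympCov k P₀ X)) ∧
    -- consistency of the covariance estimator, almost surely and in probability
    (∀ᵐ ω ∂P, Tendsto (fun n => covEstimator k (d n) n (fun i => Xs i ω)) atTop
      (𝓝 (asympCov k P₀ X))) ∧
    (∀ p q, TendstoInMeasure P (fun n ω => covEstimator k (d n) n (fun i => Xs i ω) p q) atTop
      (fun _ => asympCov k P₀ X p q)) := by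
  have hX := (h_copies 0).aemeasurable_snd
  have hXs := fun i => (h_copies i).aemeasurable_fst
  have hLa := laplace_aStar hX hX_nonneg hp
  have ha := aStar_pos hX hX_nonneg hp
  have hanti := strictAntiOn_laplace hX hX_nonneg hp
  have hcov : asympCov k P₀ X = covMat P₀ fun ω =>
    scoreVec k (moment P₀ X (aStar P₀ X)) (aStar P₀ X) (X ω) := rfl
  have htar : target k P₀ X = paramVec k (moment P₀ X (aStar P₀ X)) (aStar P₀ X) := rfl
  -- from here on `a_*` is used only through the facts above
  generalize aStar P₀ X = a at *
  have hm := moment_one_pos hX hX_nonneg hp ha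
  -- the almost sure events on which the remaining arguments are pathwise
  have h0 : ∀ᵐ ω ∂P, ∀ i, 0 ≤ Xs i ω := ae_all_iff.2 fun i =>
    (h_copies i).symm.ae_mem_snd measurableSet_Ici hX_nonneg
  have h1 : ∀ᵐ ω ∂P, ∀ r, Tendsto (fun n => empMoment n (fun i => Xs i ω) a r) atTop
      (𝓝 (moment P₀ X a r)) :=
    ae_all_iff.2 fun r => ae_tendsto_empMoment hX_nonneg h_indep h_copies ha r
  have h2 : ∀ᵐ ω ∂P, ∀ r, Tendsto (fun n => empMoment n (fun i => Xs i ω) (2 * a) r) atTop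
      (𝓝 (moment P₀ X (2 * a) r)) :=
    ae_all_iff.2 fun r =>
      ae_tendsto_empMoment hX_nonneg h_indep h_copies (mul_pos two_pos ha) r
  have hq : ∀ᵐ ω ∂P, ∀ q : ℚ, 0 < q → Tendsto (fun n => empLaplace n (fun i => Xs i ω) q) atTop
      (𝓝 (laplace P₀ X q)) := by
    refine ae_all_iff.2 fun q => ?_
    by_cases hq : 0 < q
    · filter_upwards [ae_tendsto_empMoment hX_nonneg h_indep h_copies
        (Rat.cast_pos.2 hq : (0 : ℝ) < q) 0] with ω hω _
      simpa only [empMoment_zero, moment_order_zero] using hω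
    · exact ae_of_all _ fun ω h => absurd h hq
  have hA : ∀ᵐ ω ∂P, Tendsto (fun n => empRoot (d n) n (fun i => Xs i ω)) atTop (𝓝 a) := by
    filter_upwards [h0, hq] with ω hω hω'
    exact tendsto_empRoot hω ha hanti hLa hω' d
  have hex : ∀ᵐ ω ∂P, ∀ᶠ n in atTop,
      ∃ s : ℝ, 0 < s ∧ empLaplace n (fun i => Xs i ω) s = Real.exp (-1) := by
    filter_upwards [hq] with ω hω
    exact (eventually_exists_root_near ha hanti hLa hω one_pos).mono
      fun n ⟨s, hs, _, hs'⟩ => ⟨s, hs, hs'⟩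
  have hcovlim : ∀ᵐ ω ∂P, Tendsto (fun n => covEstimator k (d n) n (fun i => Xs i ω)) atTop
      (𝓝 (asympCov k P₀ X)) := by
    filter_upwards [h0, h1, h2, hA] with ω w0 w1 w2 wA
    rw [hcov]
    exact tendsto_sampleCov_scoreVec hX hX_nonneg ha hm.ne' w0 w1 w2 wA k
  refine ⟨⟨ha, hLa, fun s hs h => hanti.injOn hs ha.le (h.trans hLa.symm)⟩, ?_, ?_, ?_, hcovlim,
    fun p q => ?_⟩
  · filter_upwards [h0, hex] with ω hω hω'
    exact hω'.mono fun n hn => existsUnique_root hω hn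
  · filter_upwards [h0, h1, hA] with ω w0 w1 wA
    rw [htar]
    refine (PiLp.continuous_toLp 2 _).continuousAt.tendsto.comp (tendsto_pi_nhds.2 fun p => ?_)
    induction p using Fin.lastCases with
    | last => simpa using wA
    | cast r => simpa using tendsto_empMoment w0 _ ha wA (w1 (r + 1))
  · rw [hcov]
    have hu := measurable_scoreVec k (moment P₀ X a) a
    have hmem := fun p =>
      memLp_scoreVec_apply hX hX_nonneg ha k (moment P₀ X a) p 2
    have clt := tendstoInDistribution_clt (h_indep.comp _ fun _ => hu)
      (fun i => (h_copies i).comp hu) hmem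
    refine tendstoInDistribution_of_sub_isLittleO clt (fun n => ?_) ?_
    · have := aemeasurable_estimator hXs h0 k (d n) n
      fun_prop
    filter_upwards [h0, h1, hA, hex] with ω w0 w1 wA wex
    rw [htar]
    refine isLittleO_estimator_sub w0 ha hm wA (wex.mono fun n hn => (empRoot_spec hn).2) w1 k
      (fun r => ?_) ?_
    -- the means of the scores, using `L_X(a) = 1/e`
    · have := integral_affine hX hX_nonneg ha 1 (moment P₀ X a (r + 2) / moment P₀ X a 1) (r + 1)
      rw [one_mul, moment_order_zero, hLa] at this
      rw [← this]
      refine integral_congr_ae (ae_of_all _ fun ω => ?_)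
      simp only [Function.comp_apply, scoreVec_castSucc]
      ring
    · have := integral_affine hX hX_nonneg ha 0 (-(moment P₀ X a 1)⁻¹) 0
      rw [moment_order_zero, hLa] at this
      calc _ = _ := integral_congr_ae (ae_of_all _ fun ω => ?_)
        _ = _ := this
        _ = _ := by ring
      simp only [Function.comp_apply, scoreVec_last]
      ring
  · refine tendstoInMeasure_of_tendsto_ae
      (fun n => (aemeasurable_covEstimator hXs h0 k (d n) n p q).aestronglyMeasurable) ?_
    filter_upwards [hcovlim] with ω hω
    exact tendsto_pi_nhds.1 (tendsto_pi_nhds.1 hω p) q
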